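/- Let $V\in C^\infty(\mathbb R,\mathbb C)$ be a $PT$-symmetric potential, i.e. $\overline{V(-x)}=V(x)$ for all $x$, let $h=-\partial^2+V(x)$, $\partial=d/dx$, and let $(PTf)(x)=\overline{f(-x)}$; all operators act on $C^\infty(\mathbb R,\mathbb C)$. For a differential operator $q=\sum_{k=0}^N w_k(x)\partial^k$ with smooth complex coefficients put $q^t=\sum_{k=0}^N(-\partial)^k w_k(x)$. A symmetry operator of $h$ is such an operator $q$ with $qh=hq$. A symmetry operator $q$ of order $N$ is minimizable if $q=\mathcal P(h)p=p\,\mathcal P(h)$ for some symmetry operator $p$ of $h$ of some order $M$ and some polynomial $\mathcal P$ of degree $(N-M)/2>0$; otherwise it is non-minimizable. Let $e=\partial^N+\sum_{k=0}^{N-1}\alpha_k(x)\partial^k$ be a non-minimizable symmetry operator of $h$ that is $t$-antisymmetric, $e^t=-e$. For a basis $\varphi_1,\dots,\varphi_n$ of $\ker e$ the matrix $\mathbf S$ of $e$ is defined by $h\varphi_i=\sum_j S_{ij}\varphi_j$; a basis of $\ker e$ is canonical if $\mathbf S$ is a Jordan form in it. Then: (0) $e$ is the unique non-minimizable $t$-antisymmetric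 symmetry operator of $h$ (of any order) with unit coefficient at the highest derivative, and $$PT\,e\,PT=-e,\qquad PT\,e=-e\,PT,\qquad PT\,h=h\,PT .$$ (1), (2) If $\lambda$ is a non-real eigenvalue of $\mathbf S$ (in any basis of $\ker e$), then $\bar\lambda$ is an eigenvalue of $\mathbf S$ of the same algebraic multiplicity. Moreover, there is a canonical basis of $\ker e$ such that every element belonging to a Jordan cell with a real eigenvalue is $PT$-symmetric ($PT\psi=\psi$), and for every Jordan cell with a non-real eigenvalue $\lambda$, with basis elements $\psi_1,\dots,\psi_k$ in order, there is a Jordan cell of the same order with eigenvalue $\bar\lambda$ whose basis elements, in order, are $PT\psi_1,\dots,PT\psi_k$. In particular, if all eigenvalues of $\mathbf S$ are real, then all elements of this canonical basis are $PT$-symmetric. -/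

import Mathlib

open scoped ContDiff ComplexConjugate

noncomputable section

namespace HiddenSymmetry

/-- The algebra `C^∞(ℝ, ℂ)` of smooth complex-valued functions on the real line. -/
def smoothFn : Subalgebra ℂ (ℝ → ℂ) where
  carrier := {f | ContDiff ℝ ∞ f}
  mul_mem' := by
    intro f g hf hg
    exact ContDiff.mul (show ContDiff ℝ ∞ f from hf) (show ContDiff ℝ ∞ g from hg)
  add_mem' := by
    intro f g hf hg
    exact ContDiff.add (show ContDiff ℝ ∞ f from hf) (show ContDiff ℝ ∞ g from hg)
  algebraMap_mem' := by
    intro c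
    exact (contDiff_const : ContDiff ℝ ∞ (fun _ : ℝ => c))

abbrev SmoothFn : Type := smoothFn

/-- Linear operators acting on `C^∞(ℝ, ℂ)`. -/
abbrev Op : Type := Module.End ℂ SmoothFn

theorem SmoothFn.contDiff (f : SmoothFn) : ContDiff ℝ ∞ (f : ℝ → ℂ) := f.2

/-- The derivative `∂ = d/dx`. -/
def D : Op where
  toFun f := ⟨deriv (f : ℝ → ℂ), (contDiff_infty_iff_deriv.mp f.contDiff).2⟩
  map_add' f g := by
    ext x
    exact deriv_add (f.contDiff.differentiable (by simp) x)
      (g.contDiff.differentiable (by simp) x)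
  map_smul' c f := by
    ext x
    exact deriv_const_smul c (f.contDiff.differentiable (by simp) x)

/-- The operator of multiplication by a function. -/
def mulOp (a : SmoothFn) : Op := LinearMap.mulLeft ℂ a

/-- The Hamiltonian `h = -∂² + V`. -/
def hamiltonian (V : SmoothFn) : Op := -(D ^ 2) + mulOp V

/-- The differential operator `∑_{k=0}^N α_k ∂^k`. -/
def diffOp (N : ℕ) (α : ℕ → SmoothFn) : Op :=
  ∑ k ∈ Finset.range (N + 1), mulOp (α k) * D ^ k

/-- The transpose `∑_{k=0}^N (-∂)^k α_k` of the differential operator `∑_{k=0}^N α_k ∂^k`. -/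
def transposeOp (N : ℕ) (α : ℕ → SmoothFn) : Op :=
  ∑ k ∈ Finset.range (N + 1), (-D) ^ k * mulOp (α k)

/-- `∑_{k=0}^N α_k ∂^k` is a symmetry operator of `h = -∂² + V`, that is, it commutes with `h`. -/
def IsSymmetryOp (V : SmoothFn) (N : ℕ) (α : ℕ → SmoothFn) : Prop :=
  diffOp N α * hamiltonian V = hamiltonian V * diffOp N α

/-- The symmetry operator `∑_{k=0}^N α_k ∂^k` of `h` is minimizable: it equals
`P(h) p = p P(h)` with `p` a symmetry operator of `h` of order `M` and `P` a polynomial of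
degree `(N - M) / 2 > 0`. -/
def IsMinimizable (V : SmoothFn) (N : ℕ) (α : ℕ → SmoothFn) : Prop :=
  ∃ (M : ℕ) (β : ℕ → SmoothFn) (P : Polynomial ℂ),
    β M ≠ 0 ∧ IsSymmetryOp V M β ∧
    0 < P.natDegree ∧ N = M + 2 * P.natDegree ∧
    diffOp N α = Polynomial.aeval (hamiltonian V) P * diffOp M β ∧
    diffOp N α = diffOp M β * Polynomial.aeval (hamiltonian V) P

/-- `e = ∑_{k=0}^N α_k ∂^k` is a normalized (unit coefficient at the highest derivative)
non-minimizable `t`-antisymmetric symmetry operator of `h = -∂² + V`. -/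
structure IsNormalizedAntisymmetricSymmetry (V : SmoothFn) (N : ℕ) (α : ℕ → SmoothFn) :
    Prop where
  leading : α N = 1
  symmetry : IsSymmetryOp V N α
  antisymmetric : transposeOp N α = -diffOp N α
  nonminimizable : ¬ IsMinimizable V N α

/-- The parity operator `(P f)(x) = f(-x)`. -/
def parity : SmoothFn →ₗ[ℂ] SmoothFn where
  toFun f := ⟨fun x => (f : ℝ → ℂ) (-x), f.contDiff.comp contDiff_neg⟩
  map_add' _ _ := rfl
  map_smul' _ _ := rfl

/-- Time reversal, that is, complex conjugation `(T f)(x) = conj (f(x))`. -/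
def timeReversal : SmoothFn →ₛₗ[starRingEnd ℂ] SmoothFn where
  toFun f := ⟨fun x => conj ((f : ℝ → ℂ) x), Complex.conjCLE.contDiff.comp f.contDiff⟩
  map_add' f g := by
    ext x
    exact map_add (starRingEnd ℂ) _ _
  map_smul' c f := by
    ext x
    exact map_mul (starRingEnd ℂ) _ _

/-- The antilinear operator `PT`. -/
def PT : SmoothFn →ₛₗ[starRingEnd ℂ] SmoothFn := parity.comp timeReversal

/-- A function is `PT`-symmetric if `conj (f(-x)) = f(x)` for all `x`. -/
def IsPTSymmetric (f : SmoothFn) : Prop := ∀ x : ℝ, conj ((f : ℝ → ℂ) (-x)) = (f : ℝ → ℂ) x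

/-- `S` is the matrix of the action of `h` on the family `φ`: `h φ_i = ∑_j S_{ij} φ_j`.
For a basis `φ` of `ker e` this is the matrix **S** of `e` in the basis `φ`. -/
def IsMatrixS {ι : Type} [Fintype ι] (V : SmoothFn) (φ : ι → SmoothFn) (S : Matrix ι ι ℂ) :
    Prop :=
  ∀ i, hamiltonian V (φ i) = ∑ j, S i j • φ j

/-- The Jordan cell of order `n` with eigenvalue `c`. -/
def jordanCell (n : ℕ) (c : ℂ) : Matrix (Fin n) (Fin n) ℂ :=
  Matrix.of fun i j => if i = j then c else if (i : ℕ) + 1 = (j : ℕ) then 1 else 0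

/-- The Jordan form with `m` cells, the `i`-th one of order `k i` and with eigenvalue `ev i`. -/
def jordanForm {m : ℕ} (k : Fin m → ℕ) (ev : Fin m → ℂ) :
    Matrix (Σ i, Fin (k i)) (Σ i, Fin (k i)) ℂ :=
  Matrix.blockDiagonal' fun i => jordanCell (k i) (ev i)

/-- A basis of `ker (∑_{k=0}^N α_k ∂^k)` is canonical if in it the matrix **S** is the Jordan
form with (nonempty) cells of orders `k i` and with eigenvalues `ev i`. -/
def IsCanonicalBasis (V : SmoothFn) (N : ℕ) (α : ℕ → SmoothFn) {m : ℕ} (k : Fin m → ℕ)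
    (ev : Fin m → ℂ)
    (ψ : Module.Basis (Σ i, Fin (k i)) ℂ (LinearMap.ker (diffOp N α))) : Prop :=
  (∀ i, 0 < k i) ∧ IsMatrixS V (fun s => (ψ s : SmoothFn)) (jordanForm k ev)

end HiddenSymmetry

end

/-!
Let `e` be a normalized non-minimizable `t`-antisymmetric symmetry operator of `h`.

*Uniqueness.* An operator of order `N` that commutes with `h` has a constant leading coefficient
`c`, since the coefficient of `[h, q]` at `∂^(N+1)` is `-2 c'`; if it is also `t`-antisymmetric,
then `(-1)^N c = -c`, and `N` is odd. Take a monic `t`-antisymmetric symmetry operator `E` of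
minimal order. The orders of any two `t`-antisymmetric symmetry operators have an even difference,
and `h^j E` is again one of them, so division with remainder shows that each of them is `P(h) E`
for a polynomial `P` (`exists_eq_aeval_mul`). If `deg P > 0`, the operator is minimizable; a
normalized non-minimizable one is therefore `E` itself.

*Relation to `PT`.* Conjugation by `PT` preserves `h` and multiplies the derivative by `-1`. Because
the order of `e` is odd, `-PT e PT` is monic, and it inherits the other properties of `e`. By
uniqueness it equals `e` (`IsNormalizedAntisymmetricSymmetry.conjPT_eq_neg`).

*The kernel.* Hence `PT` maps `ker e` to itself, and there it is an antilinear involution that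
commutes with `h`. The kernel is finite-dimensional, as a solution of `e f = 0` is determined by its
Cauchy data (`finiteDimensional_ker_diffOp`). The rest is linear algebra of an endomorphism that
commutes with an antilinear involution `σ` on a finite-dimensional space. Its matrices in a
basis `φ` and in `σ φ` are complex conjugate to each other, so the characteristic polynomial is real
(`charpoly_map_conj`). The involution exchanges the generalized eigenspaces of `c` and `conj c`; a
Jordan basis of the one for non-real `c` is carried to a Jordan basis of the other. For real `c` the
generalized eigenspace is the complexification of the real space of its `σ`-fixed vectors, and a
Jordan basis of the latter will do (`exists_adapted_jordan_basis`). Jordan bases of nilpotent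
endomorphisms, over `ℝ` and over `ℂ`, come from the structure theorem for modules over `K[X]`
(`exists_chain_basis_of_isNilpotent`).
-/

noncomputable section

namespace HiddenSymmetry

/-! ### Differential operators and their transposes -/

open MulOpposite

/-- A shortcut instance, without which lemmas on negation and subtraction in rings do not unify with
operators: `SmoothFn` gets its addition as a semiring but its negation as a ring. -/
instance instRingOp : Ring Op := Module.End.instRing

theorem D_mul_apply (a f : SmoothFn) : D (a * f) = a * D f + D a * f := by
  ext x
  have := deriv_mul (a.contDiff.differentiable (by simp) x) (f.contDiff.differentiable (by simp) x)
  calc deriv ((a : ℝ → ℂ) * (f : ℝ → ℂ)) x = _ := this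
    _ = _ := add_comm _ _

theorem D_mul_mulOp (a : SmoothFn) : D * mulOp a = mulOp a * D + mulOp (D a) :=
  LinearMap.ext fun f => D_mul_apply a f

theorem mulOp_mul_D (a : SmoothFn) : mulOp a * D = D * mulOp a - mulOp (D a) :=
  (sub_eq_of_eq_add (D_mul_mulOp a)).symm

/-- Pairs `(q, r)` of operators, multiplied by `(q, r) (q', r') = (q q', r' r)`. The pairs
`(q, q^t)` with `q` a differential operator lie in the subring generated by `pairD` and the image
of `pairFn`, so that identities for `q` and for `q^t` are proved simultaneously. -/
def OpPair : Type := Op × Opᵐᵒᵖ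

instance : Ring OpPair := inferInstanceAs (Ring (Op × Opᵐᵒᵖ))

instance : Algebra ℂ OpPair := inferInstanceAs (Algebra ℂ (Op × Opᵐᵒᵖ))

/-- The operator of a pair. -/
def OpPair.fst : OpPair →ₐ[ℂ] Op := AlgHom.fst ℂ Op Opᵐᵒᵖ

/-- The transpose of a pair, in the opposite ring. -/
def OpPair.snd : OpPair →ₐ[ℂ] Opᵐᵒᵖ := AlgHom.snd ℂ Op Opᵐᵒᵖ

theorem OpPair.ext {Q R : OpPair} (h : fst Q = fst R) (h' : snd Q = snd R) : Q = R :=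
  Prod.ext h h'

/-- The derivative together with its transpose. -/
def pairD : OpPair := (D, op (-D))

/-- Multiplication by a function together with its transpose. -/
def pairFn : SmoothFn →+* OpPair where
  toFun a := (mulOp a, op (mulOp a))
  map_one' := Prod.ext (LinearMap.ext fun f => one_mul f)
    (unop_injective (LinearMap.ext fun f => one_mul f))
  map_zero' := Prod.ext (LinearMap.ext fun f => zero_mul f)
    (unop_injective (LinearMap.ext fun f => zero_mul f))
  map_add' a b := Prod.ext (LinearMap.ext fun f => add_mul a b f)
    (unop_injective (LinearMap.ext fun f => add_mul a b f))
  map_mul' a b := by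
    refine Prod.ext (LinearMap.ext fun f => mul_assoc a b f) (unop_injective ?_)
    exact LinearMap.ext fun f => (congrArg (· * f) (mul_comm a b)).trans (mul_assoc b a f)

/-- The Hamiltonian together with its transpose. -/
def pairH (V : SmoothFn) : OpPair := -(pairD ^ 2) + pairFn V

theorem pairFn_smul (c : ℂ) (a : SmoothFn) : pairFn (c • a) = c • pairFn a := by
  refine Prod.ext (LinearMap.ext fun f => smul_mul_assoc c a f) (unop_injective ?_)
  exact LinearMap.ext fun f => smul_mul_assoc c a f

@[simp] theorem fst_pairD : OpPair.fst pairD = D := rfl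

@[simp] theorem snd_pairD : OpPair.snd pairD = op (-D) := rfl

@[simp] theorem fst_pairFn (a : SmoothFn) : OpPair.fst (pairFn a) = mulOp a := rfl

@[simp] theorem snd_pairFn (a : SmoothFn) : OpPair.snd (pairFn a) = op (mulOp a) := rfl

theorem pairH_fst (V : SmoothFn) : OpPair.fst (pairH V) = hamiltonian V := by
  simp [pairH, hamiltonian]

theorem pairH_snd (V : SmoothFn) : OpPair.snd (pairH V) = op (hamiltonian V) := by
  simp [pairH, hamiltonian]

theorem pairD_mul_pairFn (a : SmoothFn) : pairD * pairFn a = pairFn a * pairD + pairFn (D a) := by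
  refine Prod.ext (D_mul_mulOp a) (unop_injective ?_)
  change mulOp a * (-D) = -D * mulOp a + mulOp (D a)
  rw [mul_neg, mulOp_mul_D]
  noncomm_ring

/-- Exchange of the components, an anti-automorphism that restricts to the transposition of
differential operators. -/
def transposePair (Q : OpPair) : OpPair := (unop (OpPair.snd Q), op (OpPair.fst Q))

@[simp] theorem fst_transposePair (Q : OpPair) :
    OpPair.fst (transposePair Q) = unop (OpPair.snd Q) := rfl

@[simp] theorem snd_transposePair (Q : OpPair) :
    OpPair.snd (transposePair Q) = op (OpPair.fst Q) := rfl

theorem transposePair_mul (Q R : OpPair) :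
    transposePair (Q * R) = transposePair R * transposePair Q := rfl

theorem transposePair_add (Q R : OpPair) :
    transposePair (Q + R) = transposePair Q + transposePair R := rfl

theorem transposePair_smul (c : ℂ) (Q : OpPair) :
    transposePair (c • Q) = c • transposePair Q := rfl

theorem transposePair_pairFn (a : SmoothFn) : transposePair (pairFn a) = pairFn a := rfl

theorem transposePair_pairD_pow (n : ℕ) :
    transposePair (pairD ^ n) = (-1) ^ n * pairD ^ n := by
  rw [← neg_pow]
  apply OpPair.ext <;> simp

theorem transposePair_pairH (V : SmoothFn) : transposePair (pairH V) = pairH V := by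
  apply OpPair.ext <;> simp [pairH_fst, pairH_snd]

/-- The differential operator `∑_{k=0}^n α_k ∂^k` together with its transpose. -/
def pairOp (n : ℕ) (α : ℕ → SmoothFn) : OpPair :=
  ∑ k ∈ Finset.range (n + 1), pairFn (α k) * pairD ^ k

theorem pairOp_fst (n : ℕ) (α : ℕ → SmoothFn) : OpPair.fst (pairOp n α) = diffOp n α := by
  simp [pairOp, diffOp]

theorem pairOp_snd (n : ℕ) (α : ℕ → SmoothFn) : OpPair.snd (pairOp n α) = op (transposeOp n α) := by
  apply unop_injective
  simp [pairOp, transposeOp, Finset.unop_sum]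

theorem pairOp_succ (n : ℕ) (α : ℕ → SmoothFn) :
    pairOp (n + 1) α = pairOp n α + pairFn (α (n + 1)) * pairD ^ (n + 1) :=
  Finset.sum_range_succ _ _

theorem pairOp_congr {n : ℕ} {α β : ℕ → SmoothFn} (h : ∀ k ≤ n, α k = β k) :
    pairOp n α = pairOp n β :=
  Finset.sum_congr rfl fun k hk => by rw [h k (by simpa [Nat.lt_succ_iff] using hk)]

/-- `Q` is a differential operator (with its transpose) of order at most `n`, and `a`, which may
vanish, is its coefficient at `∂^n`. -/
def HasLeading (n : ℕ) (a : SmoothFn) (Q : OpPair) : Prop :=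
  ∃ α : ℕ → SmoothFn, α n = a ∧ Q = pairOp n α

theorem hasLeading_pairOp (n : ℕ) (α : ℕ → SmoothFn) : HasLeading n (α n) (pairOp n α) :=
  ⟨α, rfl, rfl⟩

theorem hasLeading_zero_iff {a : SmoothFn} {Q : OpPair} : HasLeading 0 a Q ↔ Q = pairFn a := by
  constructor
  · rintro ⟨α, rfl, rfl⟩
    simp [pairOp]
  · rintro rfl
    exact ⟨fun _ => a, rfl, by simp [pairOp]⟩

theorem hasLeading_succ_iff {n : ℕ} {a : SmoothFn} {Q : OpPair} :
    HasLeading (n + 1) a Q ↔ ∃ b R, HasLeading n b R ∧ Q = R + pairFn a * pairD ^ (n + 1) := by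
  constructor
  · rintro ⟨α, rfl, rfl⟩
    exact ⟨_, _, hasLeading_pairOp n α, pairOp_succ n α⟩
  · rintro ⟨b, R, ⟨α, rfl, rfl⟩, rfl⟩
    refine ⟨Function.update α (n + 1) a, by simp, ?_⟩
    rw [pairOp_succ, Function.update_self,
      pairOp_congr (α := Function.update α (n + 1) a) fun k hk =>
      Function.update_of_ne (show k ≠ n + 1 by omega) _ _]

namespace HasLeading

variable {n : ℕ} {a b : SmoothFn} {Q R : OpPair}

theorem lift (h : HasLeading n a Q) : HasLeading (n + 1) 0 Q :=
  hasLeading_succ_iff.2 ⟨a, Q, h, by simp⟩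

theorem drop (h : HasLeading (n + 1) 0 Q) : ∃ b, HasLeading n b Q := by
  obtain ⟨b, R, hR, rfl⟩ := hasLeading_succ_iff.1 h
  exact ⟨b, by simpa using hR⟩

theorem add (hQ : HasLeading n a Q) (hR : HasLeading n b R) : HasLeading n (a + b) (Q + R) := by
  obtain ⟨α, rfl, rfl⟩ := hQ
  obtain ⟨β, rfl, rfl⟩ := hR
  exact ⟨α + β, rfl, by simp [pairOp, add_mul, Finset.sum_add_distrib]⟩

theorem fn_mul (g : SmoothFn) (hQ : HasLeading n a Q) : HasLeading n (g * a) (pairFn g * Q) := by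
  obtain ⟨α, rfl, rfl⟩ := hQ
  exact ⟨fun k => g * α k, rfl, by simp [pairOp, Finset.mul_sum, mul_assoc]⟩

theorem smul (c : ℂ) (hQ : HasLeading n a Q) : HasLeading n (c • a) (c • Q) := by
  obtain ⟨α, rfl, rfl⟩ := hQ
  exact ⟨c • α, rfl, by simp [pairOp, Finset.smul_sum, pairFn_smul]⟩

theorem neg (hQ : HasLeading n a Q) : HasLeading n (-a) (-Q) := by
  simpa using hQ.smul (-1)

theorem sub (hQ : HasLeading n a Q) (hR : HasLeading n b R) : HasLeading n (a - b) (Q - R) := by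
  simpa [sub_eq_add_neg] using hQ.add hR.neg

theorem mul_D (hQ : HasLeading n a Q) : HasLeading (n + 1) a (Q * pairD) := by
  obtain ⟨α, rfl, rfl⟩ := hQ
  refine ⟨fun k => if k = 0 then 0 else α (k - 1), by simp, ?_⟩
  rw [pairOp, pairOp, Finset.sum_range_succ' _ (n + 1), Finset.sum_mul]
  simp [mul_assoc, pow_succ]

/-- The coefficients of `[∂, q]` are the derivatives of those of `q`. -/
theorem commutator_D (hQ : HasLeading n a Q) : HasLeading n (D a) (pairD * Q - Q * pairD) := by
  obtain ⟨α, rfl, rfl⟩ := hQ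
  refine ⟨fun k => D (α k), rfl, ?_⟩
  rw [pairOp, pairOp, Finset.mul_sum, Finset.sum_mul, ← Finset.sum_sub_distrib]
  refine Finset.sum_congr rfl fun k _ => ?_
  rw [← mul_assoc, pairD_mul_pairFn, add_mul, mul_assoc, mul_assoc, ← pow_succ, ← pow_succ']
  abel

theorem D_mul (hQ : HasLeading n a Q) : HasLeading (n + 1) a (pairD * Q) := by
  simpa using hQ.commutator_D.lift.add hQ.mul_D

theorem D_pow_mul_fn (n : ℕ) (g : SmoothFn) : HasLeading n g (pairD ^ n * pairFn g) := by
  induction n with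
  | zero => simp [hasLeading_zero_iff]
  | succ n ih => simpa [pow_succ', mul_assoc] using ih.D_mul

theorem mul_fn (g : SmoothFn) (hQ : HasLeading n a Q) : HasLeading n (a * g) (Q * pairFn g) := by
  induction n generalizing a Q with
  | zero =>
    rw [hasLeading_zero_iff] at hQ ⊢
    rw [hQ, map_mul]
  | succ n ih =>
    obtain ⟨b, R, hR, rfl⟩ := hasLeading_succ_iff.1 hQ
    rw [add_mul, mul_assoc]
    simpa using (ih hR).lift.add ((D_pow_mul_fn (n + 1) g).fn_mul a)

theorem H_mul (V : SmoothFn) (hQ : HasLeading n a Q) : HasLeading (n + 2) (-a) (pairH V * Q) := by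
  have := (hQ.D_mul.D_mul.neg).add (hQ.fn_mul V).lift.lift
  simpa [pairH, add_mul, pow_two, mul_assoc] using this

theorem H_pow_mul (V : SmoothFn) (hQ : HasLeading n a Q) (j : ℕ) :
    HasLeading (n + 2 * j) ((-1 : ℂ) ^ j • a) (pairH V ^ j * Q) := by
  induction j with
  | zero => simpa using hQ
  | succ j ih =>
    rw [mul_add, ← add_assoc]
    simpa [pow_succ', mul_assoc] using ih.H_mul V

/-- The coefficient of `[h, q]` at `∂^(n+1)` is `-2 a'`. -/
theorem commutator_H (V : SmoothFn) (hQ : HasLeading n a Q) :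
    HasLeading (n + 1) (-(D a + D a)) (pairH V * Q - Q * pairH V) := by
  have h := (hQ.commutator_D.D_mul.add hQ.commutator_D.mul_D).neg.add
    ((hQ.fn_mul V).sub (hQ.mul_fn V)).lift
  rw [add_zero] at h
  convert h using 1
  rw [pairH]
  noncomm_ring

/-- The transpose `∑ (-∂)^k α_k` has the leading coefficient `(-1)^n α_n`. -/
theorem transpose (hQ : HasLeading n a Q) :
    HasLeading n ((-1 : ℂ) ^ n • a) (transposePair Q) := by
  induction n generalizing a Q with
  | zero =>
    rw [hasLeading_zero_iff] at hQ ⊢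
    simp [hQ, transposePair_pairFn]
  | succ n ih =>
    obtain ⟨b, R, hR, rfl⟩ := hasLeading_succ_iff.1 hQ
    rw [transposePair_add, transposePair_mul, transposePair_pairFn, transposePair_pairD_pow]
    have := (ih hR).lift.add ((D_pow_mul_fn (n + 1) a).smul ((-1) ^ (n + 1)))
    rw [zero_add] at this
    convert this using 2
    rcases Nat.even_or_odd (n + 1) with h | h
    · rw [h.neg_one_pow, h.neg_one_pow, one_mul, one_smul]
    · rw [h.neg_one_pow, h.neg_one_pow, neg_one_mul, neg_one_smul, neg_mul]

end HasLeading

/-- The function `x ↦ x - x₀`. -/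
def shiftFn (x₀ : ℝ) : SmoothFn :=
  ⟨fun x => ((x - x₀ : ℝ) : ℂ),
    show ContDiff ℝ ∞ fun x : ℝ => ((x - x₀ : ℝ) : ℂ) from
      Complex.ofRealCLM.contDiff.comp (contDiff_id.sub contDiff_const)⟩

theorem D_shiftFn (x₀ : ℝ) : D (shiftFn x₀) = 1 := by
  ext x
  exact ((hasDerivAt_id x).sub_const x₀).ofReal_comp.deriv

theorem D_one : D (1 : SmoothFn) = 0 := by
  ext x
  exact deriv_const x (1 : ℂ)

theorem D_shiftFn_pow (x₀ : ℝ) (k : ℕ) :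
    D (shiftFn x₀ ^ (k + 1)) = ((k + 1 : ℕ) : ℂ) • shiftFn x₀ ^ k := by
  induction k with
  | zero => simp [D_shiftFn]
  | succ k ih =>
    rw [pow_succ, D_mul_apply, D_shiftFn, ih]
    push_cast
    rw [smul_mul_assoc, ← pow_succ, mul_one]
    module

theorem D_pow_shiftFn_pow_self (x₀ : ℝ) (j k : ℕ) :
    ((D ^ j) (shiftFn x₀ ^ k) : ℝ → ℂ) x₀ = if j = k then (k.factorial : ℂ) else 0 := by
  induction j generalizing k with
  | zero =>
    rcases k with _ | k
    · simp
    · simp [shiftFn]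
  | succ j ih =>
    rw [pow_succ, Module.End.mul_apply]
    rcases k with _ | k
    · simp [D_one]
    · rw [D_shiftFn_pow, map_smul]
      change ((k + 1 : ℕ) : ℂ) * ((D ^ j) (shiftFn x₀ ^ k) : ℝ → ℂ) x₀ = _
      rw [ih]
      simp [Nat.factorial_succ]

/-- The coefficients of a differential operator are determined by its values at the points `x₀` on
the functions `(x - x₀)^k`. -/
theorem coeff_eq_zero_of_diffOp_eq_zero {n : ℕ} {α : ℕ → SmoothFn} (h : diffOp n α = 0) {k : ℕ}
    (hk : k ≤ n) : α k = 0 := by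
  ext x
  have h1 : ((diffOp n α) (shiftFn x ^ k) : ℝ → ℂ) x = 0 := by rw [h]; rfl
  have h2 : ((diffOp n α) (shiftFn x ^ k) : ℝ → ℂ) x =
      ∑ j ∈ Finset.range (n + 1), (α j : ℝ → ℂ) x * ((D ^ j) (shiftFn x ^ k) : ℝ → ℂ) x := by
    rw [diffOp, LinearMap.sum_apply, AddSubmonoidClass.coe_finsetSum, Finset.sum_apply]
    rfl
  rw [h2] at h1
  simp only [D_pow_shiftFn_pow_self, mul_ite, mul_zero, Finset.sum_ite_eq', Finset.mem_range,
    Nat.lt_succ_of_le hk, if_true, mul_eq_zero, Nat.cast_eq_zero, Nat.factorial_ne_zero,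
    or_false] at h1
  exact h1

theorem HasLeading.eq_zero {n : ℕ} {a : SmoothFn} {Q : OpPair} (hQ : HasLeading n a Q)
    (h : OpPair.fst Q = 0) : Q = 0 ∧ a = 0 := by
  obtain ⟨α, rfl, rfl⟩ := hQ
  rw [pairOp_fst] at h
  have hα : ∀ k ≤ n, α k = 0 := fun k hk => coeff_eq_zero_of_diffOp_eq_zero h hk
  refine ⟨?_, hα n le_rfl⟩
  rw [pairOp_congr (β := 0) hα]
  simp [pairOp]

theorem HasLeading.leading_unique {n : ℕ} {a b : SmoothFn} {Q : OpPair} (hQ : HasLeading n a Q)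
    (hQ' : HasLeading n b Q) : a = b :=
  sub_eq_zero.1 ((hQ.sub hQ').eq_zero (by simp)).2

theorem exists_eq_smul_one_of_D_eq_zero {a : SmoothFn} (h : D a = 0) :
    ∃ c : ℂ, a = c • (1 : SmoothFn) := by
  refine ⟨(a : ℝ → ℂ) 0, ?_⟩
  ext x
  have := is_const_of_deriv_eq_zero (a.contDiff.differentiable (by simp))
    (fun x => congrFun (congrArg Subtype.val h) x) x 0
  simpa using this

/-- The `t`-antisymmetric operators that commute with `h`. -/
def skewSymmetries (V : SmoothFn) : Submodule ℂ OpPair where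
  carrier := {Q | transposePair Q = -Q ∧ Commute (pairH V) Q}
  zero_mem' := ⟨by simp [transposePair]; rfl, Commute.zero_right _⟩
  add_mem' {Q R} hQ hR :=
    ⟨by rw [transposePair_add, hQ.1, hR.1, neg_add], hQ.2.add_right hR.2⟩
  smul_mem' c Q hQ := ⟨by rw [transposePair_smul, hQ.1, smul_neg], hQ.2.smul_right c⟩

theorem H_mul_mem_skewSymmetries {V : SmoothFn} {Q : OpPair} (hQ : Q ∈ skewSymmetries V) :
    pairH V * Q ∈ skewSymmetries V :=
  ⟨by rw [transposePair_mul, hQ.1, transposePair_pairH, neg_mul, hQ.2.eq],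
    (Commute.refl _).mul_right hQ.2⟩

theorem H_pow_mul_mem_skewSymmetries {V : SmoothFn} {Q : OpPair} (hQ : Q ∈ skewSymmetries V)
    (j : ℕ) : pairH V ^ j * Q ∈ skewSymmetries V := by
  induction j with
  | zero => simpa using hQ
  | succ j ih => simpa [pow_succ', mul_assoc] using H_mul_mem_skewSymmetries ih

/-- The leading coefficient of an operator commuting with `h` is constant. -/
theorem HasLeading.exists_const {V : SmoothFn} {n : ℕ} {a : SmoothFn} {Q : OpPair}
    (h : HasLeading n a Q) (hc : Commute (pairH V) Q) : ∃ c : ℂ, a = c • (1 : SmoothFn) := by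
  have h1 := h.commutator_H V
  have h2 := (h1.eq_zero (by rw [hc.eq, sub_self]; rfl)).2
  apply exists_eq_smul_one_of_D_eq_zero
  have h3 : (2 : ℂ) • D a = 0 := by rw [two_smul, ← neg_eq_zero, h2]
  simpa using h3

theorem HasLeading.odd_of_skew {V : SmoothFn} {n : ℕ} {a : SmoothFn} {Q : OpPair}
    (h : HasLeading n a Q) (ha : a ≠ 0) (hs : Q ∈ skewSymmetries V) : Odd n := by
  rw [← Nat.not_even_iff_odd]
  intro hn
  have h1 := h.transpose
  rw [hs.1, hn.neg_one_pow, one_smul] at h1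
  have h2 := h.neg.leading_unique h1
  have h3 : (2 : ℂ) • a = 0 := by
    rw [two_smul]; nth_rewrite 1 [← h2]; simp
  exact ha (by simpa using h3)

/-- Let `E` be monic of order `N` and of minimal order among the monic `t`-antisymmetric
symmetry operators. Every `t`-antisymmetric symmetry operator `Q` is then `P(h) E`: both orders
are odd, so subtracting a multiple of `h^j E` lowers the order of `Q`. -/
theorem exists_eq_aeval_mul {V : SmoothFn} {N : ℕ} {E : OpPair} (hE : HasLeading N 1 E)
    (hEs : E ∈ skewSymmetries V)
    (hmin : ∀ n Q, HasLeading n 1 Q → Q ∈ skewSymmetries V → N ≤ n)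
    (n : ℕ) (a : SmoothFn) (Q : OpPair) (hQ : HasLeading n a Q) (hQs : Q ∈ skewSymmetries V) :
    ∃ P : Polynomial ℂ, Q = Polynomial.aeval (pairH V) P * E ∧
      (P = 0 ∨ N + 2 * P.natDegree ≤ n) ∧ (a ≠ 0 → n = N + 2 * P.natDegree) := by
  induction n generalizing a Q with
  | zero =>
    have ha : a = 0 := by
      by_contra ha
      simpa using hQ.odd_of_skew ha hQs
    refine ⟨0, ?_, Or.inl rfl, fun h => (h ha).elim⟩
    rw [hasLeading_zero_iff.1 hQ, ha]
    simp
  | succ n ih =>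
    by_cases ha : a = 0
    · obtain ⟨b, hb⟩ := (ha ▸ hQ).drop
      obtain ⟨P, hP, hd, -⟩ := ih b Q hb hQs
      exact ⟨P, hP, hd.imp_right fun h => by omega, fun h => (h ha).elim⟩
    obtain ⟨c, rfl⟩ := hQ.exists_const hQs.2
    have hc : c ≠ 0 := fun h => ha (by simp [h])
    have hN : N ≤ n + 1 := by
      refine hmin _ (c⁻¹ • Q) ?_ (Submodule.smul_mem _ _ hQs)
      simpa [smul_smul, hc] using hQ.smul c⁻¹
    obtain ⟨j, hj⟩ : ∃ j, n + 1 = N + 2 * j := by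
      obtain ⟨u, hu⟩ := hQ.odd_of_skew ha hQs
      obtain ⟨v, hv⟩ := hE.odd_of_skew one_ne_zero hEs
      exact ⟨u - v, by omega⟩
    -- `h^j E` has the leading coefficient `(-1)^j`
    have hR := (hE.H_pow_mul V j).smul (c * (-1) ^ j)
    rw [smul_smul, mul_assoc, ← mul_pow, neg_one_mul, neg_neg, one_pow, mul_one, ← hj] at hR
    have hS := hQ.sub hR
    rw [sub_self] at hS
    obtain ⟨b, hb⟩ := hS.drop
    obtain ⟨P, hP, hd, -⟩ := ih b _ hb (Submodule.sub_mem _ hQs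
      (Submodule.smul_mem _ _ (H_pow_mul_mem_skewSymmetries hEs j)))
    have hX := Polynomial.natDegree_C_mul_X_pow j (c * (-1) ^ j) (mul_ne_zero hc (by simp))
    have hdeg : (P + Polynomial.C (c * (-1) ^ j) * Polynomial.X ^ j).natDegree = j := by
      rcases hd with rfl | hd
      · rw [zero_add, hX]
      · rw [Polynomial.natDegree_add_eq_right_of_natDegree_lt (by omega), hX]
    refine ⟨P + Polynomial.C (c * (-1) ^ j) * Polynomial.X ^ j, ?_, Or.inr ?_, fun _ => ?_⟩
    · rw [map_add, add_mul, ← hP, ← Polynomial.smul_eq_C_mul, map_smul, map_pow,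
        Polynomial.aeval_X, smul_mul_assoc, sub_add_cancel]
    · rw [hdeg, hj]
    · rw [hdeg, hj]

theorem pairOp_mem_skewSymmetries {V : SmoothFn} {N : ℕ} {α : ℕ → SmoothFn}
    (hs : IsSymmetryOp V N α) (ht : transposeOp N α = -diffOp N α) :
    pairOp N α ∈ skewSymmetries V := by
  have hs' : diffOp N α * hamiltonian V = hamiltonian V * diffOp N α := hs
  refine ⟨OpPair.ext ?_ ?_, OpPair.ext ?_ ?_⟩
  · rw [fst_transposePair, pairOp_snd, map_neg, pairOp_fst, unop_op, ht]
  · rw [snd_transposePair, map_neg, pairOp_snd, pairOp_fst, ht]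
    exact (neg_neg (op (diffOp N α))).symm
  · rw [map_mul, map_mul, pairOp_fst, pairH_fst, hs']
  · rw [map_mul, map_mul, pairOp_snd, pairH_snd, ht, ← op_mul, ← op_mul]
    congr 1
    exact (neg_mul _ _).trans ((congrArg _ hs').trans (mul_neg _ _).symm)

theorem fst_aeval_pairH (V : SmoothFn) (P : Polynomial ℂ) :
    OpPair.fst (Polynomial.aeval (pairH V) P) = Polynomial.aeval (hamiltonian V) P := by
  rw [← Polynomial.aeval_algHom_apply, pairH_fst]

/-- A normalized non-minimizable `t`-antisymmetric symmetry operator coincides with every monic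
`t`-antisymmetric symmetry operator of minimal order. -/
theorem IsNormalizedAntisymmetricSymmetry.eq_of_minimal {V : SmoothFn} {N M : ℕ}
    {α β : ℕ → SmoothFn} (he : IsNormalizedAntisymmetricSymmetry V N α) (hβ : β M = 1)
    (hβs : pairOp M β ∈ skewSymmetries V)
    (hmin : ∀ n Q, HasLeading n 1 Q → Q ∈ skewSymmetries V → M ≤ n) :
    N = M ∧ diffOp N α = diffOp M β := by
  have hE : HasLeading M 1 (pairOp M β) := hβ ▸ hasLeading_pairOp M β
  have hQ : HasLeading N 1 (pairOp N α) := he.leading ▸ hasLeading_pairOp N α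
  have hQs := pairOp_mem_skewSymmetries he.symmetry he.antisymmetric
  obtain ⟨P, hP, -, hd⟩ := exists_eq_aeval_mul hE hβs hmin N 1 _ hQ hQs
  replace hd := hd one_ne_zero
  have hcomm : Commute (hamiltonian V) (diffOp M β) := by
    have := hβs.2.map OpPair.fst
    rwa [pairH_fst, pairOp_fst] at this
  have hfst := congrArg OpPair.fst hP
  rw [map_mul, pairOp_fst, pairOp_fst, fst_aeval_pairH] at hfst
  have h0 : P.natDegree = 0 := by
    by_contra h0
    refine he.nonminimizable ⟨M, β, P, by simp [hβ], hcomm.symm.eq, Nat.pos_of_ne_zero h0, hd,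
      hfst, ?_⟩
    rw [hfst]
    rw [Polynomial.aeval_eq_sum_range]
    exact (Commute.sum_left _ _ _ fun i _ => (hcomm.pow_left i).smul_left _).eq
  obtain ⟨c, rfl⟩ := Polynomial.natDegree_eq_zero.1 h0
  obtain rfl : N = M := by simpa using hd
  rw [Polynomial.aeval_C, ← Algebra.smul_def] at hP hfst
  have hc := hQ.leading_unique (hP ▸ hE.smul c)
  have hc1 : c = 1 := by
    have := congrFun (congrArg Subtype.val hc) 0
    simpa using this.symm
  exact ⟨rfl, by rw [hfst, hc1, one_smul]⟩

/-- There is at most one normalized non-minimizable `t`-antisymmetric symmetry operator. -/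
theorem IsNormalizedAntisymmetricSymmetry.unique {V : SmoothFn} {N M : ℕ}
    {α β : ℕ → SmoothFn} (he : IsNormalizedAntisymmetricSymmetry V N α)
    (he' : IsNormalizedAntisymmetricSymmetry V M β) : M = N ∧ diffOp M β = diffOp N α := by
  classical
  have hex : ∃ n, ∃ Q, HasLeading n 1 Q ∧ Q ∈ skewSymmetries V :=
    ⟨N, _, he.leading ▸ hasLeading_pairOp N α,
      pairOp_mem_skewSymmetries he.symmetry he.antisymmetric⟩
  obtain ⟨E, ⟨γ, hγ, rfl⟩, hEs⟩ := Nat.find_spec hex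
  have hmin : ∀ n Q, HasLeading n 1 Q → Q ∈ skewSymmetries V → Nat.find hex ≤ n :=
    fun n Q hQ hQs => Nat.find_min' hex ⟨Q, hQ, hQs⟩
  have h1 := he.eq_of_minimal hγ hEs hmin
  have h2 := he'.eq_of_minimal hγ hEs hmin
  exact ⟨h2.1.trans h1.1.symm, h2.2.trans h1.2.symm⟩

/-! ### Conjugation by `PT` -/

theorem PT_apply (f : SmoothFn) (x : ℝ) : (PT f : ℝ → ℂ) x = conj ((f : ℝ → ℂ) (-x)) := rfl

theorem isPTSymmetric_iff (f : SmoothFn) : IsPTSymmetric f ↔ PT f = f :=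
  ⟨fun h => Subtype.ext (funext h), fun h x => congrFun (congrArg Subtype.val h) x⟩

theorem PT_PT (f : SmoothFn) : PT (PT f) = f := by
  ext x
  simp [PT_apply]

theorem PT_mul (f g : SmoothFn) : PT (f * g) = PT f * PT g := by
  ext x
  exact map_mul (starRingEnd ℂ) _ _

theorem PT_one : PT 1 = 1 := by
  ext x
  exact map_one (starRingEnd ℂ)

theorem D_PT (f : SmoothFn) : D (PT f) = -PT (D f) := by
  ext x
  have h := f.contDiff.differentiable (by simp) (-x)
  have h1 : HasDerivAt (fun y : ℝ => (f : ℝ → ℂ) (-y)) (-deriv (f : ℝ → ℂ) (-x)) x := by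
    have := h.hasDerivAt.scomp x (hasDerivAt_neg x)
    rwa [neg_one_smul] at this
  have h2 := (Complex.conjCLE : ℂ →L[ℝ] ℂ).hasFDerivAt.comp_hasDerivAt x h1
  refine Eq.trans (show _ = deriv (fun y => conj ((f : ℝ → ℂ) (-y))) x from rfl)
    ((HasDerivAt.deriv h2).trans ?_)
  exact map_neg (starRingEnd ℂ) _

/-- Conjugation `q ↦ PT q PT` of operators by the antilinear involution `PT`. -/
def conjPT : Op →+* Op where
  toFun q :=
    { toFun := fun f => PT (q (PT f))
      map_add' := fun f g => by simp only [map_add]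
      map_smul' := fun c f => by simp [LinearMap.map_smulₛₗ] }
  map_one' := LinearMap.ext PT_PT
  map_zero' := LinearMap.ext fun f => map_zero PT
  map_add' q r := LinearMap.ext fun f => map_add PT _ _
  map_mul' q r := LinearMap.ext fun f => by
    change PT (q (r (PT f))) = PT (q (PT (PT (r (PT f)))))
    rw [PT_PT]

theorem conjPT_apply (q : Op) (f : SmoothFn) : conjPT q f = PT (q (PT f)) := rfl

theorem conjPT_conjPT (q : Op) : conjPT (conjPT q) = q :=
  LinearMap.ext fun f => by simp only [conjPT_apply, PT_PT]

theorem conjPT_D : conjPT D = -D :=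
  LinearMap.ext fun f => by
    rw [conjPT_apply, D_PT, map_neg, PT_PT]
    rfl

theorem conjPT_mulOp (a : SmoothFn) : conjPT (mulOp a) = mulOp (PT a) :=
  LinearMap.ext fun f => by
    rw [conjPT_apply]
    exact (PT_mul a (PT f)).trans (congrArg _ (PT_PT f))

theorem conjPT_smul (c : ℂ) (q : Op) : conjPT (c • q) = conj c • conjPT q :=
  LinearMap.ext fun _ => LinearMap.map_smulₛₗ PT c _

theorem conjPT_hamiltonian {V : SmoothFn} (hV : IsPTSymmetric V) :
    conjPT (hamiltonian V) = hamiltonian V := by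
  rw [hamiltonian, map_add, conjPT_mulOp, (isPTSymmetric_iff V).1 hV]
  congr 1
  exact (map_neg conjPT _).trans (by rw [map_pow, conjPT_D, neg_sq])

theorem conjPT_aeval_hamiltonian {V : SmoothFn} (hV : IsPTSymmetric V) (P : Polynomial ℂ) :
    conjPT (Polynomial.aeval (hamiltonian V) P) =
      Polynomial.aeval (hamiltonian V) (P.map (starRingEnd ℂ)) := by
  rw [Polynomial.aeval_eq_sum_range, Polynomial.aeval_eq_sum_range,
    Polynomial.natDegree_map, map_sum]
  simp only [conjPT_smul, map_pow, conjPT_hamiltonian hV, Polynomial.coeff_map]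

/-- The coefficients of `-PT q PT`, where `q` has the coefficients `α`. -/
def negConjCoeff (α : ℕ → SmoothFn) (k : ℕ) : SmoothFn := (-1 : ℂ) ^ (k + 1) • PT (α k)

theorem mulOp_smul (c : ℂ) (a : SmoothFn) : mulOp (c • a) = c • mulOp a :=
  LinearMap.ext fun f => smul_mul_assoc c a f

theorem neg_D_pow (k : ℕ) : (-D) ^ k = (-1 : ℂ) ^ k • D ^ k := by
  rw [← smul_pow, neg_one_smul]

theorem conjPT_diffOp (N : ℕ) (α : ℕ → SmoothFn) :
    conjPT (diffOp N α) = -diffOp N (negConjCoeff α) := by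
  rw [diffOp, diffOp, map_sum, ← Finset.sum_neg_distrib]
  refine Finset.sum_congr rfl fun k _ => ?_
  rw [map_mul, map_pow, conjPT_D, conjPT_mulOp, neg_D_pow, negConjCoeff, mulOp_smul, pow_succ,
    mul_neg_one, neg_smul, mul_smul_comm, neg_mul, smul_mul_assoc, neg_neg]

theorem conjPT_transposeOp (N : ℕ) (α : ℕ → SmoothFn) :
    conjPT (transposeOp N α) = -transposeOp N (negConjCoeff α) := by
  rw [transposeOp, transposeOp, map_sum, ← Finset.sum_neg_distrib]
  refine Finset.sum_congr rfl fun k _ => ?_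
  rw [map_mul, map_pow, map_neg, conjPT_D, neg_neg, conjPT_mulOp, neg_D_pow, negConjCoeff,
    mulOp_smul, pow_succ, mul_neg_one, neg_smul, mul_neg, neg_neg, smul_mul_smul_comm, ← mul_pow,
    neg_one_mul, neg_neg, one_pow, one_smul]

theorem diffOp_negConjCoeff (N : ℕ) (α : ℕ → SmoothFn) :
    diffOp N (negConjCoeff α) = -conjPT (diffOp N α) := by
  rw [conjPT_diffOp, neg_neg]

theorem conjPT_diffOp_negConjCoeff (N : ℕ) (α : ℕ → SmoothFn) :
    conjPT (diffOp N (negConjCoeff α)) = -diffOp N α := by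
  rw [diffOp_negConjCoeff, map_neg, conjPT_conjPT]

theorem IsSymmetryOp.negConjCoeff {V : SmoothFn} (hV : IsPTSymmetric V) {N : ℕ}
    {α : ℕ → SmoothFn} (h : IsSymmetryOp V N α) :
    IsSymmetryOp V N (negConjCoeff α) := by
  have h' := congrArg conjPT h
  rw [map_mul, map_mul, conjPT_hamiltonian hV] at h'
  rw [IsSymmetryOp, diffOp_negConjCoeff, neg_mul, mul_neg, h']

theorem negConjCoeff_ne_zero {α : ℕ → SmoothFn} {k : ℕ} (h : α k ≠ 0) : negConjCoeff α k ≠ 0 := by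
  intro h0
  rw [negConjCoeff, smul_eq_zero_iff_right (by simp)] at h0
  exact h (by rw [← PT_PT (α k), h0, map_zero])

theorem IsMinimizable.of_negConjCoeff {V : SmoothFn} (hV : IsPTSymmetric V) {N : ℕ}
    {α : ℕ → SmoothFn} (h : IsMinimizable V N (negConjCoeff α)) : IsMinimizable V N α := by
  obtain ⟨M, β, P, hβ, hs, hP, hN, h1, h2⟩ := h
  refine ⟨M, negConjCoeff β, P.map (starRingEnd ℂ), negConjCoeff_ne_zero hβ, hs.negConjCoeff hV,
    by rwa [Polynomial.natDegree_map], by rwa [Polynomial.natDegree_map], ?_, ?_⟩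
  · have := congrArg conjPT h1
    rw [conjPT_diffOp_negConjCoeff, map_mul, conjPT_aeval_hamiltonian hV, conjPT_diffOp,
      mul_neg] at this
    exact neg_injective this
  · have := congrArg conjPT h2
    rw [conjPT_diffOp_negConjCoeff, map_mul, conjPT_aeval_hamiltonian hV, conjPT_diffOp,
      neg_mul] at this
    exact neg_injective this

/-- If `e` is a normalized non-minimizable `t`-antisymmetric symmetry operator of a `PT`-symmetric
Hamiltonian, then so is `-PT e PT`. -/
theorem IsNormalizedAntisymmetricSymmetry.negConjCoeff {V : SmoothFn} (hV : IsPTSymmetric V)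
    {N : ℕ} {α : ℕ → SmoothFn} (he : IsNormalizedAntisymmetricSymmetry V N α) :
    IsNormalizedAntisymmetricSymmetry V N (negConjCoeff α) where
  leading := by
    -- the order is odd, which turns `(-1)^(N+1)` into `1`
    have hQ : HasLeading N 1 (pairOp N α) := he.leading ▸ hasLeading_pairOp N α
    have hN : Odd N :=
      hQ.odd_of_skew one_ne_zero (pairOp_mem_skewSymmetries he.symmetry he.antisymmetric)
    rw [HiddenSymmetry.negConjCoeff, he.leading, PT_one, hN.add_one.neg_one_pow, one_smul]
  symmetry := he.symmetry.negConjCoeff hV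
  antisymmetric := by
    have := congrArg conjPT he.antisymmetric
    rw [map_neg, conjPT_transposeOp, conjPT_diffOp] at this
    exact neg_injective this
  nonminimizable h := he.nonminimizable (h.of_negConjCoeff hV)

/-- By uniqueness `-PT e PT = e`. -/
theorem IsNormalizedAntisymmetricSymmetry.conjPT_eq_neg {V : SmoothFn} (hV : IsPTSymmetric V)
    {N : ℕ} {α : ℕ → SmoothFn} (he : IsNormalizedAntisymmetricSymmetry V N α) :
    conjPT (diffOp N α) = -diffOp N α := by
  rw [conjPT_diffOp, (he.unique (he.negConjCoeff hV)).2]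

theorem PT_hamiltonian {V : SmoothFn} (hV : IsPTSymmetric V) (f : SmoothFn) :
    PT (hamiltonian V f) = hamiltonian V (PT f) := by
  have := LinearMap.congr_fun (conjPT_hamiltonian hV) (PT f)
  rwa [conjPT_apply, PT_PT] at this

theorem IsNormalizedAntisymmetricSymmetry.PT_diffOp_PT {V : SmoothFn} (hV : IsPTSymmetric V)
    {N : ℕ} {α : ℕ → SmoothFn} (he : IsNormalizedAntisymmetricSymmetry V N α) (f : SmoothFn) :
    PT (diffOp N α (PT f)) = -diffOp N α f :=
  LinearMap.congr_fun (he.conjPT_eq_neg hV) f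

theorem IsNormalizedAntisymmetricSymmetry.PT_diffOp {V : SmoothFn} (hV : IsPTSymmetric V)
    {N : ℕ} {α : ℕ → SmoothFn} (he : IsNormalizedAntisymmetricSymmetry V N α) (f : SmoothFn) :
    PT (diffOp N α f) = -diffOp N α (PT f) := by
  have := he.PT_diffOp_PT hV (PT f)
  rwa [PT_PT] at this

/-! ### The kernel of a monic differential operator -/

theorem hasDerivAt_smoothFn (f : SmoothFn) (x : ℝ) :
    HasDerivAt (f : ℝ → ℂ) ((D f : ℝ → ℂ) x) x :=
  (f.contDiff.differentiable (by simp) x).hasDerivAt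

/-- A curve in a normed space that vanishes at `0` and whose velocity is bounded by a continuous
multiple of its norm vanishes identically. -/
theorem eq_zero_of_norm_deriv_le {E : Type*} [NormedAddCommGroup E] [NormedSpace ℝ E]
    {u u' : ℝ → E} {K : ℝ → ℝ} (hK : Continuous K) (hu : ∀ t, HasDerivAt u (u' t) t)
    (h0 : u 0 = 0) (hb : ∀ t, ‖u' t‖ ≤ K t * ‖u t‖) (t : ℝ) : u t = 0 := by
  have key : ∀ {v v' : ℝ → E} {L : ℝ → ℝ}, Continuous L → (∀ t, HasDerivAt v (v' t) t) →
      v 0 = 0 → (∀ t, ‖v' t‖ ≤ L t * ‖v t‖) → ∀ t, 0 ≤ t → v t = 0 := by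
    intro v v' L hL hv hv0 hvb t ht
    obtain ⟨C, hC⟩ := (isCompact_Icc (a := (0 : ℝ)) (b := t)).bddAbove_image hL.continuousOn
    refine eq_zero_of_abs_deriv_le_mul_abs_self_of_eq_zero_right (K := C) (a := 0) (b := t)
      (fun s _ => (hv s).continuousAt.continuousWithinAt) (fun s _ => (hv s).hasDerivWithinAt) hv0
      (fun s hs => (hvb s).trans ?_) t ⟨ht, le_rfl⟩
    exact mul_le_mul_of_nonneg_right (hC ⟨s, ⟨hs.1, hs.2.le⟩, rfl⟩) (norm_nonneg _)
  rcases le_total 0 t with ht | ht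
  · exact key hK hu h0 hb t ht
  · have := key (v := fun s => u (-s)) (v' := fun s => -u' (-s)) (L := fun s => K (-s))
      (hK.comp continuous_neg) (fun s => by
        have := (hu (-s)).scomp s (hasDerivAt_neg s)
        rwa [neg_one_smul] at this) (by simpa using h0)
      (fun s => by simpa using hb (-s)) (-t) (by linarith)
    simpa using this

/-- The Cauchy data at `0` of length `N`. -/
def cauchyData (N : ℕ) : SmoothFn →ₗ[ℂ] (Fin N → ℂ) where
  toFun f k := ((D ^ (k : ℕ)) f : ℝ → ℂ) 0
  map_add' f g := by ext k; simp
  map_smul' c f := by ext k; simp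

/-- A solution of a monic linear differential equation with vanishing Cauchy data is zero. -/
theorem eq_zero_of_cauchyData_eq_zero {N : ℕ} {α : ℕ → SmoothFn} (hα : α N = 1) {f : SmoothFn}
    (hf : diffOp N α f = 0) (h0 : cauchyData N f = 0) : f = 0 := by
  -- the jet of `f`, a solution of a first order system
  let u : ℝ → Fin N → ℂ := fun t k => ((D ^ (k : ℕ)) f : ℝ → ℂ) t
  let u' : ℝ → Fin N → ℂ := fun t k => ((D ^ (k + 1 : ℕ)) f : ℝ → ℂ) t
  have hu : ∀ t, HasDerivAt u (u' t) t := fun t => hasDerivAt_pi.2 fun k => by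
    have := hasDerivAt_smoothFn ((D ^ (k : ℕ)) f) t
    rwa [← Module.End.mul_apply, ← pow_succ'] at this
  have htop : ∀ t, ((D ^ N) f : ℝ → ℂ) t = -∑ k : Fin N, (α k : ℝ → ℂ) t * u t k := by
    intro t
    have h1 : (diffOp N α f : ℝ → ℂ) t =
        ∑ k ∈ Finset.range (N + 1), (α k : ℝ → ℂ) t * ((D ^ k) f : ℝ → ℂ) t := by
      rw [diffOp, LinearMap.sum_apply, AddSubmonoidClass.coe_finsetSum, Finset.sum_apply]
      rfl
    rw [hf, Finset.sum_range_succ, hα, Finset.sum_range] at h1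
    have h2 : (0 : ℂ) = _ + 1 * _ := h1
    rw [one_mul] at h2
    exact eq_neg_of_add_eq_zero_right h2.symm
  have hu0 : ∀ t, u t = 0 := by
    refine eq_zero_of_norm_deriv_le (K := fun t => 1 + ∑ k : Fin N, ‖(α k : ℝ → ℂ) t‖) ?_ hu h0 ?_
    · exact continuous_const.add (continuous_finsetSum _ fun k _ =>
        (α k).contDiff.continuous.norm)
    · intro t
      have hs : 0 ≤ ∑ k : Fin N, ‖(α k : ℝ → ℂ) t‖ := Finset.sum_nonneg fun _ _ => norm_nonneg _
      refine (pi_norm_le_iff_of_nonneg (by positivity)).2 fun k => ?_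
      rw [add_mul, one_mul]
      by_cases hk : (k : ℕ) + 1 < N
      · exact (norm_le_pi_norm (u t) ⟨k + 1, hk⟩).trans
          (le_add_of_nonneg_right (mul_nonneg hs (norm_nonneg _)))
      · have hk' : (k : ℕ) + 1 = N := by omega
        have h3 : u' t k = -∑ k : Fin N, (α k : ℝ → ℂ) t * u t k := by
          rw [← htop t, ← hk']
        rw [h3, norm_neg]
        refine ((norm_sum_le _ _).trans ?_).trans (le_add_of_nonneg_left (norm_nonneg _))
        rw [Finset.sum_mul]
        refine Finset.sum_le_sum fun j _ => ?_
        rw [norm_mul]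
        exact mul_le_mul_of_nonneg_left (norm_le_pi_norm _ _) (norm_nonneg _)
  ext t
  rcases Nat.eq_zero_or_pos N with rfl | hN
  · simpa using htop t
  · exact congrFun (hu0 t) ⟨0, hN⟩

theorem finiteDimensional_ker_diffOp {N : ℕ} {α : ℕ → SmoothFn} (hα : α N = 1) :
    FiniteDimensional ℂ (LinearMap.ker (diffOp N α)) := by
  refine FiniteDimensional.of_injective
    ((cauchyData N).comp (LinearMap.ker (diffOp N α)).subtype) ?_
  rw [injective_iff_map_eq_zero]
  rintro ⟨f, hf⟩ h
  exact Subtype.ext (eq_zero_of_cauchyData_eq_zero hα hf h)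

/-! ### Chain bases and antilinear involutions -/

open Polynomial in
/-- The basis `1, X, …, X^(k-1)` of `K[X] / (X^k)`. -/
def quotientXPowBasis (K : Type*) [Field K] (k : ℕ) :
    Module.Basis (Fin k) K (K[X] ⧸ K[X] ∙ (X ^ k : K[X])) :=
  ((AdjoinRoot.powerBasis' (monic_X_pow k)).basis.reindex (finCongr (natDegree_X_pow k)) :
    Module.Basis (Fin k) K (AdjoinRoot (X ^ k : K[X])))

open Polynomial in
theorem quotientXPowBasis_apply (K : Type*) [Field K] (k : ℕ) (j : Fin k) :
    quotientXPowBasis K k j = Submodule.Quotient.mk (X ^ (j : ℕ)) := by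
  have h : ((AdjoinRoot.powerBasis' (monic_X_pow k)).basis.reindex (finCongr (natDegree_X_pow k)) :
      Module.Basis (Fin k) K (AdjoinRoot (X ^ k : K[X]))) j =
      AdjoinRoot.mk (X ^ k : K[X]) (X ^ (j : ℕ)) := by
    rw [Module.Basis.reindex_apply, PowerBasis.coe_basis, map_pow, AdjoinRoot.mk_X]
    rfl
  exact h

open Polynomial in
theorem X_smul_quotientXPowBasis (K : Type*) [Field K] (k : ℕ) (j : Fin k) :
    (X : K[X]) • quotientXPowBasis K k j =
      if h : (j : ℕ) + 1 < k then quotientXPowBasis K k ⟨j + 1, h⟩ else 0 := by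
  rw [quotientXPowBasis_apply, ← Submodule.Quotient.mk_smul, smul_eq_mul, ← pow_succ']
  split_ifs with h
  · rw [quotientXPowBasis_apply]
  · have hj : (j : ℕ) + 1 = k := by omega
    rw [hj, Submodule.Quotient.mk_eq_zero]
    exact Submodule.mem_span_singleton_self _

theorem dfinsupp_basis_apply {K ι : Type*} [Field K] [DecidableEq ι] {X : ι → Type*}
    [∀ i, AddCommGroup (X i)] [∀ i, Module K (X i)] {η : ι → Type*}
    (b : ∀ i, Module.Basis (η i) K (X i)) (i : ι) (j : η i) :
    DFinsupp.basis b ⟨i, j⟩ = DFinsupp.single i (b i j) := by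
  rw [Module.Basis.apply_eq_iff]
  change (sigmaFinsuppLequivDFinsupp K).symm (DFinsupp.mapRange.linearEquiv (fun i => (b i).repr)
    (DFinsupp.single i (b i j))) = _
  rw [LinearEquiv.symm_apply_eq, DFinsupp.mapRange.linearEquiv_apply, DFinsupp.mapRange_single,
    Module.Basis.repr_self]
  exact (sigmaFinsuppEquivDFinsupp_single ⟨i, j⟩ (1 : K)).symm

open Polynomial in
/-- A nilpotent endomorphism has a basis that consists of chains `v, g v, …, g^(k-1) v` with
`g^k v = 0`: the vector space is a finitely generated torsion module over `K[X]`, `X` acting as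
`g`, and therefore a direct sum of modules `K[X] / (X^k)`. The lengths of the chains and the vectors
are values of functions on `ℕ`, of which the values outside the basis are irrelevant. -/
theorem exists_chain_basis_of_isNilpotent {K W : Type*} [Field K] [AddCommGroup W] [Module K W]
    [FiniteDimensional K W] {g : Module.End K W} (hg : IsNilpotent g) :
    ∃ (m : ℕ) (k : ℕ → ℕ) (v : ℕ → ℕ → W),
      (∃ b : Module.Basis (Σ i : Fin m, Fin (k i)) K W, ∀ s, b s = v s.1 s.2) ∧
      ∀ i < m, ∀ j < k i, g (v i j) = if j + 1 < k i then v i (j + 1) else 0 := by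
  obtain ⟨n, hn⟩ := hg
  have htors : Module.IsTorsion' (Module.AEval' g) (Submonoid.powers (X : K[X])) := by
    intro x
    refine ⟨⟨X ^ n, n, rfl⟩, ?_⟩
    obtain ⟨w, rfl⟩ := (Module.AEval'.of g).surjective x
    change (X ^ n : K[X]) • Module.AEval'.of g w = 0
    rw [Module.AEval'.X_pow_smul_of, hn, zero_smul, map_zero]
  obtain ⟨m, k, ⟨e⟩⟩ := Module.torsion_by_prime_power_decomposition irreducible_X htors
  obtain ⟨k, rfl⟩ : ∃ k' : ℕ → ℕ, k = fun i : Fin m => k' i :=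
    ⟨fun i => if h : i < m then k ⟨i, h⟩ else 0, by ext i; simp⟩
  let e' : Module.AEval' g ≃ₗ[K[X]] (Π₀ i : Fin m, K[X] ⧸ K[X] ∙ (X ^ k i : K[X])) := e
  let b := (DFinsupp.basis fun i : Fin m => quotientXPowBasis K (k i)).map
    ((e'.restrictScalars K).symm.trans (Module.AEval'.of g).symm)
  have hb : ∀ i j, b ⟨i, j⟩ =
      (Module.AEval'.of g).symm (e'.symm (DFinsupp.single i (quotientXPowBasis K (k i) j))) := by
    intro i j
    rw [Module.Basis.map_apply, dfinsupp_basis_apply]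
    rfl
  have hg : ∀ (i : Fin m) (j : Fin (k i)), g (b ⟨i, j⟩) =
      if h : (j : ℕ) + 1 < k i then b ⟨i, ⟨j + 1, h⟩⟩ else 0 := by
    intro i j
    have h1 : g (b ⟨i, j⟩) = (Module.AEval'.of g).symm
        (e'.symm (DFinsupp.single i ((X : K[X]) • quotientXPowBasis K (k i) j))) := by
      rw [hb, ← Module.AEval'.of_symm_X_smul, ← map_smul e'.symm, DFinsupp.single_smul]
    rw [h1, X_smul_quotientXPowBasis]
    split_ifs with h
    · rw [hb]
    · simp
  refine ⟨m, k, fun i j => if h : ∃ h : i < m, j < k i then b ⟨⟨i, h.1⟩, ⟨j, h.2⟩⟩ else 0,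
    ⟨b, ?_⟩, fun i hi j hj => ?_⟩
  · rintro ⟨i, j⟩
    have h : ∃ _ : (i : ℕ) < m, (j : ℕ) < k i := ⟨i.2, j.2⟩
    dsimp only
    rw [dif_pos h]
  · have h : ∃ _ : i < m, j < k i := ⟨hi, hj⟩
    dsimp only
    rw [dif_pos h, hg ⟨i, hi⟩ ⟨j, hj⟩]
    dsimp only
    split_ifs with h1 h2
    · rfl
    · exact (h2 ⟨hi, h1⟩).elim
    · rfl

section Antilinear

variable {W : Type*} [AddCommGroup W] [Module ℂ W]

theorem exists_basis_of_span_eq {ι : Type*} {G : Submodule ℂ W} {v : ι → W}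
    (hv : LinearIndependent ℂ v) (hs : Submodule.span ℂ (Set.range v) = G) :
    ∃ b : Module.Basis ι ℂ G, ∀ i, (b i : W) = v i := by
  subst hs
  exact ⟨Module.Basis.span hv, fun i => congrArg Subtype.val (Module.Basis.span_apply hv i)⟩

theorem linearIndependent_coe_basis {ι : Type*} {G : Submodule ℂ W} {v : ι → W}
    (b : Module.Basis ι ℂ G) (hb : ∀ i, (b i : W) = v i) :
    LinearIndependent ℂ v ∧ Submodule.span ℂ (Set.range v) = G := by
  obtain rfl : v = fun i => (b i : W) := funext fun i => (hb i).symm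
  refine ⟨b.linearIndependent.map' G.subtype G.ker_subtype, ?_⟩
  have := congrArg (Submodule.map G.subtype) b.span_eq
  rwa [Submodule.map_span, Submodule.map_top, Submodule.range_subtype, ← Set.range_comp] at this

variable {σ : W →ₛₗ[starRingEnd ℂ] W}

theorem linearIndependent_antilinear (hσ : ∀ x, σ (σ x) = x) {ι : Type*} {v : ι → W}
    (hv : LinearIndependent ℂ v) : LinearIndependent ℂ fun i => σ (v i) := by
  rw [linearIndependent_iff'] at hv ⊢
  intro s c hc i hi
  have h := congrArg σ hc
  simp only [map_sum, LinearMap.map_smulₛₗ, hσ, map_zero] at h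
  simpa using hv s _ h i hi

theorem span_antilinear {ι : Type*} (v : ι → W) :
    Submodule.span ℂ (Set.range fun i => σ (v i)) =
      (Submodule.span ℂ (Set.range v)).map σ := by
  rw [Submodule.map_span, ← Set.range_comp]
  rfl

/-- Vectors fixed by an antilinear involution that are independent over `ℝ` are independent
over `ℂ`. -/
theorem linearIndependent_complex_of_real {ι : Type*} {v : ι → W}
    (hσv : ∀ i, σ (v i) = v i) (hv : LinearIndependent ℝ v) : LinearIndependent ℂ v := by
  rw [linearIndependent_iff'] at hv ⊢
  intro s c hc i hi
  have h := congrArg σ hc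
  simp only [map_sum, LinearMap.map_smulₛₗ, hσv, map_zero] at h
  have hre : ∑ i ∈ s, (c i).re • v i = 0 := by
    have h1 : ∑ i ∈ s, (c i).re • v i =
        (1 / 2 : ℂ) • (∑ i ∈ s, c i • v i + ∑ i ∈ s, conj (c i) • v i) := by
      rw [← Finset.sum_add_distrib, Finset.smul_sum]
      refine Finset.sum_congr rfl fun i _ => ?_
      rw [← add_smul, smul_smul, Complex.add_conj, ← Complex.coe_smul]
      congr 1
      push_cast
      ring
    rw [h1, hc, h, add_zero, smul_zero]
  have him : ∑ i ∈ s, (c i).im • v i = 0 := by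
    have h1 : ∑ i ∈ s, (c i).im • v i =
        (-Complex.I / 2 : ℂ) • (∑ i ∈ s, c i • v i - ∑ i ∈ s, conj (c i) • v i) := by
      rw [← Finset.sum_sub_distrib, Finset.smul_sum]
      refine Finset.sum_congr rfl fun i _ => ?_
      rw [← sub_smul, smul_smul, Complex.sub_conj, ← Complex.coe_smul]
      congr 1
      push_cast
      linear_combination ((c i).im : ℂ) * Complex.I_sq
    rw [h1, hc, h, sub_zero, smul_zero]
  exact Complex.ext (hv s _ hre i hi) (hv s _ him i hi)

end Antilinear

/-! ### Jordan bases adapted to an antilinear involution -/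

/-- A number `m` of chains, their lengths `k i` and their members `v i j`, where `i < m` and
`j < k i`; the other values of `k` and `v` are irrelevant. -/
structure ChainData (W : Type*) where
  /-- The number of chains. -/
  m : ℕ
  /-- The lengths of the chains. -/
  k : ℕ → ℕ
  /-- The members of the chains. -/
  v : ℕ → ℕ → W

section Antilinear

variable {W : Type*} [AddCommGroup W] [Module ℂ W]

/-- The chains are Jordan chains of `f` with the eigenvalue `c` and form a basis of the generalized
eigenspace. -/
structure ChainData.IsJordan (d : ChainData W) (f : Module.End ℂ W) (c : ℂ) : Prop where
  basis : ∃ b : Module.Basis (Σ i : Fin d.m, Fin (d.k i)) ℂ (f.maxGenEigenspace c),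
    ∀ s, (b s : W) = d.v s.1 s.2
  chain : ∀ i < d.m, ∀ j < d.k i,
    f (d.v i j) = c • d.v i j + if j + 1 < d.k i then d.v i (j + 1) else 0

/-- The chains with all their members mapped by `σ`. -/
def ChainData.map (σ : W → W) (d : ChainData W) : ChainData W :=
  ⟨d.m, d.k, fun i j => σ (d.v i j)⟩

variable {σ : W →ₛₗ[starRingEnd ℂ] W} {f : Module.End ℂ W}

theorem sub_pow_antilinear (hf : ∀ x, σ (f x) = f (σ x)) (c : ℂ) (n : ℕ) (x : W) :
    σ (((f - c • (1 : Module.End ℂ W)) ^ n) x) =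
      ((f - conj c • (1 : Module.End ℂ W)) ^ n) (σ x) := by
  induction n generalizing x with
  | zero => rfl
  | succ n ih =>
    rw [pow_succ, pow_succ, Module.End.mul_apply, Module.End.mul_apply, ih]
    simp [hf, LinearMap.map_smulₛₗ]

theorem antilinear_mem_maxGenEigenspace (hf : ∀ x, σ (f x) = f (σ x)) {c : ℂ} {x : W}
    (hx : x ∈ f.maxGenEigenspace c) : σ x ∈ f.maxGenEigenspace (conj c) := by
  rw [Module.End.mem_maxGenEigenspace] at hx ⊢
  obtain ⟨n, hn⟩ := hx
  exact ⟨n, by rw [← sub_pow_antilinear hf, hn, map_zero]⟩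

theorem ChainData.IsJordan.map (hσ : ∀ x, σ (σ x) = x) (hf : ∀ x, σ (f x) = f (σ x))
    {d : ChainData W} {c : ℂ} (hd : d.IsJordan f c) : (d.map σ).IsJordan f (conj c) where
  basis := by
    obtain ⟨b, hb⟩ := hd.basis
    obtain ⟨hli, hs⟩ := linearIndependent_coe_basis b hb
    refine exists_basis_of_span_eq (linearIndependent_antilinear hσ hli)
      ((span_antilinear (σ := σ) _).trans ((congrArg (Submodule.map σ) hs).trans ?_))
    refine le_antisymm (Submodule.map_le_iff_le_comap.2 fun x hx =>
      antilinear_mem_maxGenEigenspace hf hx) fun x hx => ⟨σ x, ?_, hσ x⟩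
    have := antilinear_mem_maxGenEigenspace hf hx
    rwa [Complex.conj_conj] at this
  chain i hi j hj := by
    change f (σ (d.v i j)) = conj c • σ (d.v i j) + if j + 1 < d.k i then σ (d.v i (j + 1)) else 0
    rw [← hf, hd.chain i hi j hj, map_add, LinearMap.map_smulₛₗ, apply_ite σ, map_zero]

theorem exists_isJordan [FiniteDimensional ℂ W] (f : Module.End ℂ W) (c : ℂ) :
    ∃ d : ChainData W, d.IsJordan f c := by
  obtain ⟨m, k, v, ⟨b, hb⟩, hv⟩ := exists_chain_basis_of_isNilpotent
    (f.isNilpotent_restrict_maxGenEigenspace_sub_algebraMap c)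
  refine ⟨⟨m, k, fun i j => v i j⟩, ⟨b, fun s => congrArg Subtype.val (hb s)⟩, fun i hi j hj => ?_⟩
  have h := congrArg Subtype.val (hv i hi j hj)
  have h' : f (v i j) - c • (v i j : W) = _ := h
  rw [sub_eq_iff_eq_add'] at h'
  rw [h', apply_ite Subtype.val]
  rfl

/-- For a real eigenvalue the chains can be chosen in the real space of fixed vectors of the
antilinear involution, where `f - c` is nilpotent as well. -/
theorem exists_isJordan_fixed [FiniteDimensional ℂ W] (hσ : ∀ x, σ (σ x) = x)
    (hf : ∀ x, σ (f x) = f (σ x)) (c : ℝ) :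
    ∃ d : ChainData W, d.IsJordan f c ∧ ∀ i < d.m, ∀ j < d.k i, σ (d.v i j) = d.v i j := by
  have hσG : ∀ x ∈ f.maxGenEigenspace c, σ x ∈ f.maxGenEigenspace c := fun x hx => by
    simpa using antilinear_mem_maxGenEigenspace hf hx
  let F : Submodule ℝ W :=
    { carrier := {x | x ∈ f.maxGenEigenspace c ∧ σ x = x}
      add_mem' := fun hx hy => ⟨Submodule.add_mem _ hx.1 hy.1, by rw [map_add, hx.2, hy.2]⟩
      zero_mem' := ⟨Submodule.zero_mem _, map_zero σ⟩
      smul_mem' := fun r x hx => ⟨by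
          rw [← Complex.coe_smul]; exact Submodule.smul_mem _ _ hx.1, by
          rw [← Complex.coe_smul, LinearMap.map_smulₛₗ, Complex.conj_ofReal, hx.2]⟩ }
  let g : Module.End ℝ W := (f - (c : ℂ) • (1 : Module.End ℂ W)).restrictScalars ℝ
  have hgF : ∀ x ∈ F, g x ∈ F := by
    rintro x ⟨hx, hx'⟩
    refine ⟨Module.End.mapsTo_maxGenEigenspace_of_comm
      (Algebra.mul_sub_algebraMap_commutes f (c : ℂ)) c hx, ?_⟩
    have := sub_pow_antilinear hf (c : ℂ) 1 x
    rwa [pow_one, pow_one, Complex.conj_ofReal, hx'] at this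
  have hpow : ∀ (n : ℕ) (x : F), (((g.restrict hgF) ^ n) x : W) =
      ((f - (c : ℂ) • (1 : Module.End ℂ W)) ^ n) x := by
    intro n
    induction n with
    | zero => intro x; rfl
    | succ n ih =>
      intro x
      rw [pow_succ, pow_succ, Module.End.mul_apply, Module.End.mul_apply, ih]
      rfl
  have hnil : IsNilpotent (g.restrict hgF) := by
    refine ⟨Module.finrank ℂ W, LinearMap.ext fun x => Subtype.ext ?_⟩
    rw [hpow]
    have hx := x.2.1
    rw [Module.End.maxGenEigenspace_eq_genEigenspace_finrank, Module.End.mem_genEigenspace_nat]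
      at hx
    exact hx
  obtain ⟨m, k, v, ⟨b, hb⟩, hv⟩ := exists_chain_basis_of_isNilpotent hnil
  refine ⟨⟨m, k, fun i j => v i j⟩, ⟨?_, fun i hi j hj => ?_⟩, fun i _ j _ => (v i j).2.2⟩
  · have hli : LinearIndependent ℝ fun s => (b s : W) :=
      b.linearIndependent.map' F.subtype F.ker_subtype
    have hspan : Submodule.span ℝ (Set.range fun s => (b s : W)) = F := by
      have := congrArg (Submodule.map F.subtype) b.span_eq
      rwa [Submodule.map_span, Submodule.map_top, Submodule.range_subtype,
        ← Set.range_comp] at this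
    obtain ⟨b', hb'⟩ := exists_basis_of_span_eq (G := f.maxGenEigenspace c)
      (linearIndependent_complex_of_real (σ := σ) (fun s => (b s).2.2) hli) (by
        refine le_antisymm (Submodule.span_le.2 ?_) fun x hx => ?_
        · rintro _ ⟨s, rfl⟩
          exact (b s).2.1
        · have hF : ∀ y ∈ F, y ∈ Submodule.span ℂ (Set.range fun s => (b s : W)) := fun y hy =>
            Submodule.span_subset_span ℝ ℂ _
            (show y ∈ Submodule.span ℝ _ by rw [hspan]; exact hy)
          -- the decomposition into a real and an imaginary part
          have h1 : x + σ x ∈ F := ⟨Submodule.add_mem _ hx (hσG x hx), by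
            rw [map_add, hσ, add_comm]⟩
          have h2 : Complex.I • (x - σ x) ∈ F :=
            ⟨Submodule.smul_mem _ _ (Submodule.sub_mem _ hx (hσG x hx)), by
              rw [LinearMap.map_smulₛₗ, map_sub, hσ, Complex.conj_I, neg_smul, ← smul_neg,
                neg_sub]⟩
          have h3 : x = (1 / 2 : ℂ) • (x + σ x) +
              (-Complex.I / 2) • (Complex.I • (x - σ x)) := by
            rw [smul_smul, div_mul_eq_mul_div, neg_mul, Complex.I_mul_I]
            module
          rw [h3]
          exact Submodule.add_mem _ (Submodule.smul_mem _ _ (hF _ h1))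
            (Submodule.smul_mem _ _ (hF _ h2)))
    exact ⟨b', fun s => (hb' s).trans (congrArg Subtype.val (hb s))⟩
  · have h := congrArg Subtype.val (hv i hi j hj)
    have h' : f (v i j) - (c : ℂ) • (v i j : W) = _ := h
    rw [sub_eq_iff_eq_add'] at h'
    rw [h', apply_ite Subtype.val]
    rfl

/-- Jordan chains for all generalized eigenspaces, compatible with the antilinear involution: it
fixes the chains of a real eigenvalue and carries those of a non-real eigenvalue `c` to those of
`conj c`. -/
theorem exists_isJordan_family [FiniteDimensional ℂ W] (hσ : ∀ x, σ (σ x) = x)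
    (hf : ∀ x, σ (f x) = f (σ x)) :
    ∃ d : ℂ → ChainData W, (∀ c, (d c).IsJordan f c) ∧
      (∀ c : ℂ, c.im = 0 → ∀ i < (d c).m, ∀ j < (d c).k i, σ ((d c).v i j) = (d c).v i j) ∧
      (∀ c : ℂ, c.im ≠ 0 → d (conj c) = (d c).map σ) := by
  have h0 : ∀ c : ℂ, ∃ d : ChainData W, d.IsJordan f c ∧
      (c.im = 0 → ∀ i < d.m, ∀ j < d.k i, σ (d.v i j) = d.v i j) := by
    intro c
    by_cases hc : c.im = 0
    · obtain ⟨r, rfl⟩ : ∃ r : ℝ, c = r := ⟨c.re, Complex.ext rfl hc⟩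
      obtain ⟨d, hd, hd'⟩ := exists_isJordan_fixed hσ hf r
      exact ⟨d, hd, fun _ => hd'⟩
    · obtain ⟨d, hd⟩ := exists_isJordan f c
      exact ⟨d, hd, fun h => (hc h).elim⟩
  choose d hd hd' using h0
  -- the chosen chains in the closed upper half plane, their images in the lower one
  refine ⟨fun c => if c.im < 0 then (d (conj c)).map σ else d c, fun c => ?_, fun c hc => ?_,
    fun c hc => ?_⟩
  · dsimp only
    split_ifs
    · simpa using (hd (conj c)).map hσ hf
    · exact hd c
  · simpa [hc] using hd' c hc
  · dsimp only
    rw [Complex.conj_im, Complex.conj_conj]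
    rcases lt_or_gt_of_ne hc with h | h
    · rw [if_neg (by linarith), if_pos h]
      simp [ChainData.map, hσ]
    · rw [if_pos (by linarith), if_neg (by linarith)]

theorem isInternal_maxGenEigenspace [FiniteDimensional ℂ W] (f : Module.End ℂ W) :
    DirectSum.IsInternal fun c : f.Eigenvalues => f.maxGenEigenspace (c : ℂ) := by
  refine DirectSum.isInternal_submodule_of_iSupIndep_of_iSup_eq_top
    (f.independent_maxGenEigenspace.comp Subtype.val_injective) ?_
  rw [eq_top_iff, ← Module.End.iSup_maxGenEigenspace_eq_top f]
  refine iSup_le fun c => ?_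
  by_cases hc : f.HasEigenvalue c
  · exact le_iSup (fun c : f.Eigenvalues => f.maxGenEigenspace (c : ℂ)) ⟨c, hc⟩
  · have : f.maxGenEigenspace c = ⊥ := by
      by_contra h
      exact hc (Module.End.HasUnifEigenvalue.lt zero_lt_one (show f.HasUnifEigenvalue c ⊤ from h))
    rw [this]
    exact bot_le

/-- An endomorphism that commutes with an antilinear involution `σ` has a Jordan basis whose cells
with real eigenvalues consist of fixed vectors of `σ` and whose other cells are permuted by `σ`. -/
theorem exists_adapted_jordan_basis [FiniteDimensional ℂ W] (hσ : ∀ x, σ (σ x) = x)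
    (hf : ∀ x, σ (f x) = f (σ x)) :
    ∃ (m : ℕ) (k : Fin m → ℕ) (ev : Fin m → ℂ) (ψ : Module.Basis (Σ i, Fin (k i)) ℂ W),
      (∀ i, 0 < k i) ∧
      (∀ i (j : Fin (k i)), f (ψ ⟨i, j⟩) =
        ev i • ψ ⟨i, j⟩ + if h : (j : ℕ) + 1 < k i then ψ ⟨i, ⟨j + 1, h⟩⟩ else 0) ∧
      (∀ i, (ev i).im = 0 → ∀ j, σ (ψ ⟨i, j⟩) = ψ ⟨i, j⟩) ∧
      (∀ i, (ev i).im ≠ 0 → ∃ (i' : Fin m) (hk : k i = k i'), ev i' = conj (ev i) ∧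
        ∀ j : Fin (k i), σ (ψ ⟨i, j⟩) = ψ ⟨i', Fin.cast hk j⟩) := by
  classical
  obtain ⟨d, hd, hreal, hconj⟩ := exists_isJordan_family hσ hf
  choose b hb using fun c => (hd c).basis
  -- the nonempty chains
  let ι := {p : Σ c : f.Eigenvalues, Fin (d c).m // 0 < (d p.1).k p.2}
  let len : ι → ℕ := fun p => (d p.1.1).k p.1.2
  let e : Fin (Fintype.card ι) ≃ ι := (Fintype.equivFin ι).symm
  let B := (isInternal_maxGenEigenspace f).collectedBasis fun c => b c
  let E : (Σ i, Fin (len (e i))) ≃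
      Σ c : f.Eigenvalues, Σ i : Fin (d c).m, Fin ((d c).k i) :=
    ((Equiv.sigmaCongrLeft (β := fun p : ι => Fin (len p)) e).trans
      (Equiv.sigmaSubtypeEquivOfSubset
        (fun p : Σ c : f.Eigenvalues, Fin (d c).m => Fin ((d p.1).k p.2)) _
        fun p j => Nat.zero_lt_of_lt j.2)).trans
      (Equiv.sigmaAssoc fun (c : f.Eigenvalues) (i : Fin (d c).m) => Fin ((d c).k i))
  have hψ : ∀ i (j : Fin (len (e i))), B.reindex E.symm ⟨i, j⟩ =
      (d (e i).1.1).v (e i).1.2 j := by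
    intro i j
    rw [Module.Basis.reindex_apply, Equiv.symm_symm, DirectSum.IsInternal.collectedBasis_coe]
    exact hb _ _
  refine ⟨_, fun i => len (e i), fun i => (e i).1.1, B.reindex E.symm, fun i => (e i).2,
    fun i j => ?_, fun i hi j => ?_, fun i hi => ?_⟩
  · rw [hψ, (hd _).chain _ (e i).1.2.2 j j.2]
    congr 1
    split_ifs with h1
    · rw [hψ]
    · rfl
  · rw [hψ]
    exact hreal _ hi _ (e i).1.2.2 j j.2
  · have hev : f.HasEigenvalue (conj ((e i).1.1 : ℂ)) := by
      have hx : f.HasEigenvalue ((e i).1.1 : ℂ) := (e i).1.1.2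
      obtain ⟨x, hx⟩ := hx.exists_hasEigenvector
      refine Module.End.hasEigenvalue_of_hasEigenvector (x := σ x) ⟨?_, fun h => hx.2 ?_⟩
      · rw [Module.End.mem_eigenspace_iff, ← hf, hx.apply_eq_smul, LinearMap.map_smulₛₗ]
      · rw [← hσ x, h, map_zero]
    let c' : f.Eigenvalues := ⟨conj ((e i).1.1 : ℂ), hev⟩
    have hc : d c' = (d (e i).1.1).map σ := hconj _ hi
    have hm : (d c').m = (d (e i).1.1).m := by rw [hc]; rfl
    have hk : ∀ l, (d c').k l = (d (e i).1.1).k l := fun l => by rw [hc]; rfl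
    have hv : ∀ l j, (d c').v l j = σ ((d (e i).1.1).v l j) := fun l j => by
      rw [hc]; rfl
    let p : ι := ⟨⟨c', Fin.cast hm.symm (e i).1.2⟩, by
      rw [hk]; exact (e i).2⟩
    have hp : e (e.symm p) = p := e.apply_symm_apply p
    refine ⟨e.symm p, ?_, ?_, fun j => ?_⟩
    · change len (e i) = len (e (e.symm p))
      rw [hp]
      exact (hk _).symm
    · change ((e (e.symm p)).1.1 : ℂ) = _
      rw [hp]
      rfl
    · have hpv : ∀ j, (d (e (e.symm p)).1.1).v (e (e.symm p)).1.2 j =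
          (d p.1.1).v p.1.2 j := fun j => by rw [hp]
      rw [hψ, hψ]
      exact ((hpv j).trans (hv _ _)).symm

/-- The matrices of `f` in the bases `φ` and `σ φ` are complex conjugate to each other and have the
same characteristic polynomial, which is therefore real. -/
theorem charpoly_map_conj [FiniteDimensional ℂ W] (hσ : ∀ x, σ (σ x) = x)
    (hf : ∀ x, σ (f x) = f (σ x)) {n : Type*} [Fintype n] [DecidableEq n]
    (φ : Module.Basis n ℂ W) {S : Matrix n n ℂ}
    (hS : ∀ i, f (φ i) = ∑ j, S i j • φ j) : S.charpoly.map (starRingEnd ℂ) = S.charpoly := by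
  have key : ∀ (χ : Module.Basis n ℂ W) (T : Matrix n n ℂ),
      (∀ i, f (χ i) = ∑ j, T i j • χ j) → T.charpoly = f.charpoly := by
    intro χ T hT
    have : LinearMap.toMatrix χ χ f = T.transpose := by
      ext i j
      rw [LinearMap.toMatrix_apply, hT, map_sum]
      simp [Finsupp.single_apply]
    rw [← Matrix.charpoly_transpose, ← this]
    exact LinearMap.charpoly_toMatrix f χ
  let φ' : Module.Basis n ℂ W :=
    Module.Basis.mk (linearIndependent_antilinear hσ φ.linearIndependent) (by
      rw [span_antilinear, φ.span_eq]
      exact fun x _ => ⟨σ x, trivial, hσ x⟩)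
  have hφ' : ∀ i, φ' i = σ (φ i) := fun i => Module.Basis.mk_apply _ _ i
  rw [← Matrix.charpoly_map, key φ S hS]
  refine key φ' _ fun i => ?_
  simp only [hφ', Matrix.map_apply, ← hf, hS, map_sum, LinearMap.map_smulₛₗ]

end Antilinear

/-! ### The matrix of the Hamiltonian on the kernel -/

/-- The restriction of `PT` to a submodule that it preserves. -/
def restrictPT (G : Submodule ℂ SmoothFn) (h : ∀ f ∈ G, PT f ∈ G) : G →ₛₗ[starRingEnd ℂ] G where
  toFun f := ⟨PT f, h f f.2⟩
  map_add' f g := Subtype.ext (map_add PT (f : SmoothFn) g)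
  map_smul' c f := Subtype.ext (LinearMap.map_smulₛₗ PT c (f : SmoothFn))

theorem hamiltonian_mem_ker {V : SmoothFn} {N : ℕ} {α : ℕ → SmoothFn} (h : IsSymmetryOp V N α) :
    ∀ f ∈ LinearMap.ker (diffOp N α), hamiltonian V f ∈ LinearMap.ker (diffOp N α) := by
  intro f hf
  have h1 := LinearMap.congr_fun h f
  rw [Module.End.mul_apply, Module.End.mul_apply, LinearMap.mem_ker.1 hf, map_zero] at h1
  exact h1

/-- The row `(i, j)` of a Jordan form has `ev i` on the diagonal and, unless the cell ends there,
a `1` to the right of it. -/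
theorem sum_jordanForm_smul {W : Type*} [AddCommGroup W] [Module ℂ W] {m : ℕ} (k : Fin m → ℕ)
    (ev : Fin m → ℂ) (ψ : (Σ i, Fin (k i)) → W) (i : Fin m) (j : Fin (k i)) :
    ∑ s, jordanForm k ev ⟨i, j⟩ s • ψ s =
      ev i • ψ ⟨i, j⟩ + if h : (j : ℕ) + 1 < k i then ψ ⟨i, ⟨j + 1, h⟩⟩ else 0 := by
  have h1 : ∀ i' (j' : Fin (k i')), i' ≠ i → jordanForm k ev ⟨i, j⟩ ⟨i', j'⟩ = 0 := by
    intro i' j' h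
    exact Matrix.blockDiagonal'_apply_ne _ _ _ h.symm
  have h2 : ∀ j' : Fin (k i), jordanForm k ev ⟨i, j⟩ ⟨i, j'⟩ =
      (if j = j' then ev i else 0) + if (j : ℕ) + 1 = j' then 1 else 0 := by
    intro j'
    rw [jordanForm, Matrix.blockDiagonal'_apply_eq, jordanCell, Matrix.of_apply]
    split_ifs with h h' <;> simp_all
  rw [Fintype.sum_sigma, Finset.sum_eq_single i
    (fun i' _ h => Finset.sum_eq_zero fun j' _ => by rw [h1 i' j' h, zero_smul]) (by simp)]
  simp only [h2, add_smul, Finset.sum_add_distrib, ite_smul, zero_smul, one_smul,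
    Finset.sum_ite_eq, Finset.mem_univ, if_true]
  congr 1
  split_ifs with h
  · rw [Finset.sum_eq_single ⟨j + 1, h⟩ (fun j' _ h' => if_neg fun h'' => h' (Fin.ext h''.symm))
      (by simp)]
    exact if_pos rfl
  · exact Finset.sum_eq_zero fun j' _ => if_neg fun h' => h (by omega)

end HiddenSymmetry

end

theorem mainTheorem6 (V : HiddenSymmetry.SmoothFn) (hV : HiddenSymmetry.IsPTSymmetric V)
    (N : ℕ) (α : ℕ → HiddenSymmetry.SmoothFn)
    (he : HiddenSymmetry.IsNormalizedAntisymmetricSymmetry V N α) :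
    -- uniqueness of `e`
    (∀ (M : ℕ) (β : ℕ → HiddenSymmetry.SmoothFn),
      HiddenSymmetry.IsNormalizedAntisymmetricSymmetry V M β →
        M = N ∧ HiddenSymmetry.diffOp M β = HiddenSymmetry.diffOp N α) ∧
    -- `PT e PT = -e`, `PT e = -e PT` and `PT h = h PT`
    (∀ f, HiddenSymmetry.PT (HiddenSymmetry.diffOp N α (HiddenSymmetry.PT f)) =
      -HiddenSymmetry.diffOp N α f) ∧
    (∀ f, HiddenSymmetry.PT (HiddenSymmetry.diffOp N α f) =
      -HiddenSymmetry.diffOp N α (HiddenSymmetry.PT f)) ∧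
    (∀ f, HiddenSymmetry.PT (HiddenSymmetry.hamiltonian V f) =
      HiddenSymmetry.hamiltonian V (HiddenSymmetry.PT f)) ∧
    -- non-real eigenvalues of **S** (in any basis of `ker e`) come in conjugate pairs
    (∀ (n : ℕ) (φ : Module.Basis (Fin n) ℂ (LinearMap.ker (HiddenSymmetry.diffOp N α)))
      (S : Matrix (Fin n) (Fin n) ℂ),
      HiddenSymmetry.IsMatrixS V (fun i => (φ i : HiddenSymmetry.SmoothFn)) S →
      ∀ c ∈ spectrum ℂ S, c.im ≠ 0 →
        (starRingEnd ℂ) c ∈ spectrum ℂ S ∧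
        S.charpoly.rootMultiplicity ((starRingEnd ℂ) c) = S.charpoly.rootMultiplicity c) ∧
    -- a canonical basis adapted to `PT`
    (∃ (m : ℕ) (k : Fin m → ℕ) (ev : Fin m → ℂ)
      (ψ : Module.Basis (Σ i, Fin (k i)) ℂ (LinearMap.ker (HiddenSymmetry.diffOp N α))),
      HiddenSymmetry.IsCanonicalBasis V N α k ev ψ ∧
      (∀ i, (ev i).im = 0 →
        ∀ j, HiddenSymmetry.IsPTSymmetric (ψ ⟨i, j⟩ : HiddenSymmetry.SmoothFn)) ∧
      (∀ i, (ev i).im ≠ 0 →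
        ∃ (i' : Fin m) (hk : k i = k i'), ev i' = (starRingEnd ℂ) (ev i) ∧
          ∀ j : Fin (k i), HiddenSymmetry.PT (ψ ⟨i, j⟩ : HiddenSymmetry.SmoothFn) =
            (ψ ⟨i', Fin.cast hk j⟩ : HiddenSymmetry.SmoothFn)) ∧
      ((∀ i, (ev i).im = 0) →
        ∀ s, HiddenSymmetry.IsPTSymmetric (ψ s : HiddenSymmetry.SmoothFn))) := by
  open HiddenSymmetry in
  have hPT : ∀ f ∈ LinearMap.ker (diffOp N α), PT f ∈ LinearMap.ker (diffOp N α) := by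
    intro f hf
    rw [LinearMap.mem_ker] at hf ⊢
    have := he.PT_diffOp hV f
    rw [hf, map_zero, zero_eq_neg] at this
    exact this
  have := HiddenSymmetry.finiteDimensional_ker_diffOp he.leading
  let h := (HiddenSymmetry.hamiltonian V).restrict (HiddenSymmetry.hamiltonian_mem_ker he.symmetry)
  let σ := HiddenSymmetry.restrictPT _ hPT
  have hσ : ∀ f, σ (σ f) = f := fun f => Subtype.ext (HiddenSymmetry.PT_PT f)
  have hh : ∀ f, σ (h f) = h (σ f) := fun f => Subtype.ext (HiddenSymmetry.PT_hamiltonian hV f)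
  refine ⟨fun M β hβ => he.unique hβ, he.PT_diffOp_PT hV, he.PT_diffOp hV,
    HiddenSymmetry.PT_hamiltonian hV, fun n φ S hS c hc _ => ?_, ?_⟩
  · have hreal := HiddenSymmetry.charpoly_map_conj
      (W := LinearMap.ker (HiddenSymmetry.diffOp N α)) hσ hh φ (S := S) fun i => Subtype.ext (by
      rw [AddSubmonoidClass.coe_finsetSum]
      exact hS i)
    have hmult : S.charpoly.rootMultiplicity ((starRingEnd ℂ) c) =
        S.charpoly.rootMultiplicity c := by
      conv_lhs => rw [← hreal]
      exact (Polynomial.eq_rootMultiplicity_map (starRingEnd ℂ).injective c).symm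
    refine ⟨?_, hmult⟩
    rw [Matrix.mem_spectrum_iff_isRoot_charpoly] at hc ⊢
    have hne := S.charpoly_monic.ne_zero
    rw [← Polynomial.rootMultiplicity_pos hne] at hc ⊢
    rwa [hmult]
  · obtain ⟨m, k, ev, ψ, hk, hψ, hreal, hconj⟩ :=
      HiddenSymmetry.exists_adapted_jordan_basis
        (W := LinearMap.ker (HiddenSymmetry.diffOp N α)) hσ hh
    have hsym : ∀ i, (ev i).im = 0 →
        ∀ j, HiddenSymmetry.IsPTSymmetric (ψ ⟨i, j⟩ : HiddenSymmetry.SmoothFn) := fun i hi j =>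
      (HiddenSymmetry.isPTSymmetric_iff _).2 (congrArg Subtype.val (hreal i hi j))
    refine ⟨m, k, ev, ψ, ⟨hk, ?_⟩, hsym, fun i hi => ?_, fun hall s => hsym s.1 (hall s.1) s.2⟩
    · rintro ⟨i, j⟩
      have h1 := congrArg Subtype.val
        ((hψ i j).trans (HiddenSymmetry.sum_jordanForm_smul k ev ψ i j).symm)
      rw [AddSubmonoidClass.coe_finsetSum] at h1
      exact h1
    · obtain ⟨i', hk', hev, hψ'⟩ := hconj i hi
      exact ⟨i', hk', hev, fun j => congrArg Subtype.val (hψ' j)⟩
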